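/- Theorem. Let $q$ be an indeterminate, $[r]_q = 1+q+\cdots+q^{r-1}$, $[n]!_q=\prod_{r=1}^n [r]_q$, and \[T_q(m,n) = \frac{1}{1+q^n}\cdot\frac{[2m]!_q\,[2n]!_q}{[m]!_q\,[n]!_q\,[m+n]!_q}.\] Let $\mathcal{C}_n$ be the set of Catalan paths of length $2n$: the lattice paths with $n$ up steps and $n$ down steps that start at level $0$ and never go below level $0$. For a path $\pi=\pi_1\cdots\pi_{2n}$ let $D(\pi)$ be the set of all $i$ with $1\le i\le 2n-1$ such that $\pi_i$ is a down step and $\pi_{i+1}$ is an up step, and put $\mathrm{maj}(\pi)=\sum_{i\in D(\pi)} i$ and $\mathrm{des}(\pi)=|D(\pi)|$. For $n \ge 1$ and $\pi\in\mathcal{C}_n$, let $R$ be the right-most point of maximum level on $\pi$, and let $X$ be the last (from left to right) point at level one up to and including $R$. Let $h_-(\pi)$ be the maximum level that $\pi$ reaches from its beginning until and including $X$, and $h_+(\pi)$ the maximum level that $\pi$ reaches after and including $X$. Let $\Omega_n$ be the set of $\pi\in\mathcal{C}_n$ with $h_+(\pi)\le h_-(\pi)+2$. Then for every integer $n\ge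 1$, as an identity of rational functions in $q$, \[T_q(2,n) = q^{(n-1)(n-2)} + q^{3-n}\sum_{\pi\in\Omega_n} q^{\mathrm{maj}(\pi)-\mathrm{des}(\pi)}.\] -/

import Mathlib

/-!  Lattice paths as lists of up steps `U` and down steps `D`; the step `U` is the letter `0` and
the step `D` is the letter `1`. A Catalan path is a `DyckWord`. -/

namespace SuperCatalan

open DyckStep

/-- The level (height of the endpoint) of the path after its first `i` steps. -/
def level (p : List DyckStep) (i : ℕ) : ℤ :=
  ((p.take i).count U : ℤ) - ((p.take i).count D : ℤ)

/-- The descent set: the `1 ≤ i ≤ ℓ - 1` such that the `i`-th step (counted from `1`) is a down step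
and the `(i+1)`-st step is an up step. -/
def descentSet (p : List DyckStep) : Finset ℕ :=
  (Finset.Ico 1 p.length).filter fun i => p[i - 1]? = some D ∧ p[i]? = some U

/-- The major index. -/
def maj (p : List DyckStep) : ℕ := ∑ i ∈ descentSet p, i

/-- The descent index. -/
def des (p : List DyckStep) : ℕ := (descentSet p).card

/-- The maximum level on the points with indices `a, a + 1, …, b`. -/
def maxLevel (p : List DyckStep) (a b : ℕ) (h : a ≤ b) : ℤ :=
  (Finset.Icc a b).sup' (Finset.nonempty_Icc.2 h) (level p)

/-- The height of the path: the maximum level that it reaches. -/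
def height (p : List DyckStep) : ℤ := maxLevel p 0 p.length (Nat.zero_le _)

/-- The index of the right-most maximum `R`. -/
def rightmostMax (p : List DyckStep) : ℕ :=
  Nat.findGreatest (fun i => level p i = height p) p.length

/-- The index of `X`, the last level-one point up to and including the right-most maximum
(it exists on every nonempty Catalan path). -/
def lastLevelOne (p : List DyckStep) : ℕ :=
  Nat.findGreatest (fun i => level p i = 1) (rightmostMax p)

theorem lastLevelOne_le_length (p : List DyckStep) : lastLevelOne p ≤ p.length :=
  (Nat.findGreatest_le _).trans (Nat.findGreatest_le _)

/-- The maximum level from the beginning until and including `X`. -/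
def hMinus (p : List DyckStep) : ℤ := maxLevel p 0 (lastLevelOne p) (Nat.zero_le _)

/-- The maximum level after and including `X`. -/
def hPlus (p : List DyckStep) : ℤ :=
  maxLevel p (lastLevelOne p) p.length (lastLevelOne_le_length p)

/-- Catalan paths of length `2 * n`. -/
abbrev CatalanPath (n : ℕ) : Type := {p : DyckWord // p.semilength = n}

/-- The set `Ω_n` of Catalan paths of length `2 * n` with `h₊ ≤ h₋ + 2`. -/
def Omega (n : ℕ) : Finset (CatalanPath n) :=
  Finset.univ.filter fun π => hPlus π.1.toList ≤ hMinus π.1.toList + 2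

noncomputable section

/-- The indeterminate `q` of the field `ℚ(q)` of rational functions. -/
abbrev q : RatFunc ℚ := RatFunc.X

/-- `[r]_q = 1 + q + ⋯ + q ^ (r - 1)`. -/
def qInt (r : ℕ) : RatFunc ℚ := ∑ i ∈ Finset.range r, q ^ i

/-- `[n]!_q = [1]_q [2]_q ⋯ [n]_q`. -/
def qFactorial (n : ℕ) : RatFunc ℚ := ∏ r ∈ Finset.Icc 1 n, qInt r

/-- `S_q(m, n) = [2m]!_q [2n]!_q / ([m]!_q [n]!_q [m+n]!_q)`. -/
def superCatalanS (m n : ℕ) : RatFunc ℚ :=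
  (qFactorial (2 * m) * qFactorial (2 * n)) /
    (qFactorial m * qFactorial n * qFactorial (m + n))

/-- `T_q(m, n) = S_q(m, n) / (1 + q ^ n)`. -/
def superCatalanT (m n : ℕ) : RatFunc ℚ := superCatalanS m n / (1 + q ^ n)

end

end SuperCatalan

/-! Weight a path by `q` to the power maj - des; `wt 0` is this exponent, because a descent `i`
contributes the zero-based index `i - 1` of its down step. Let C be the weighted sum over all
Catalan paths of length `2 * n`, S its part outside `Omega n` (the steep paths), and P the sum over
pairs (E, F) of nonempty Catalan paths of total length `2 * n`, where with F = U F' the pair carries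
the weight of the path E D F'. The theorem is a combination of two identities: q^(n-1) T(2, n) = (1
+ q^2) C - P (`superCatalanT_two_eq`), and q^2 S + C = P + q^((n-1)^2)
(`q_sq_mul_sum_steepPairs_add`). Eliminating P leaves q^2 (C - S) + q^((n-1)^2), to be divided by
q^(n-1).

The first identity is algebraic: C and P count walks above a horizontal line by major index, a
q-reflection principle (`walkSum_eq`) turns them into differences of Gaussian binomials, and
q-integer arithmetic remains.

The second is bijective. Flipping the step before the left-most maximum preserves weights and
inverts flipping the step after the right-most one. Cutting the flipped path at its first passage to
level -1 matches Catalan paths with pairs where ht F ≤ ht E + 1 (`sum_dyck_eq_sum_dyckPairs`);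
cutting at X matches steep paths with pairs where ht F ≥ ht E + 2 (`sum_isSteep`), but with another
weight. Moving a peak from the end of E to the start of F shows that the two weights have the same
sum up to q^2 (`sum_move_peak`). Together the pairs exhaust P, except for one extra pair with E
empty and F a zigzag. -/

namespace SuperCatalan

open DyckStep

/-! ### Levels, heights and descent weights -/

/-- The height change of a step. -/
def rise : DyckStep → ℤ
  | U => 1
  | D => -1

/-- The level of the endpoint of a path. -/
def lev : List DyckStep → ℤ
  | [] => 0
  | x :: l => rise x + lev l

/-- The maximum level of a path. -/
def ht : List DyckStep → ℤ
  | [] => 0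
  | x :: l => max 0 (rise x + ht l)

/-- The minimum level of a path. -/
def mn : List DyckStep → ℤ
  | [] => 0
  | x :: l => min 0 (rise x + mn l)

/-- The sum of `k + j` over all `j` such that the steps with indices `j` and `j + 1` (counted from
zero) are a down step and an up step. -/
def wt : ℕ → List DyckStep → ℕ
  | _, [] => 0
  | _, [_] => 0
  | k, D :: U :: l => k + wt (k + 1) (U :: l)
  | k, D :: D :: l => wt (k + 1) (D :: l)
  | k, U :: y :: l => wt (k + 1) (y :: l)

@[simp] theorem rise_U : rise U = 1 := rfl
@[simp] theorem rise_D : rise D = -1 := rfl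
@[simp] theorem lev_nil : lev [] = 0 := rfl
@[simp] theorem lev_cons (x : DyckStep) (l : List DyckStep) : lev (x :: l) = rise x + lev l := rfl
@[simp] theorem ht_nil : ht [] = 0 := rfl
@[simp] theorem ht_cons (x : DyckStep) (l : List DyckStep) :
    ht (x :: l) = max 0 (rise x + ht l) := rfl
@[simp] theorem mn_nil : mn [] = 0 := rfl
@[simp] theorem mn_cons (x : DyckStep) (l : List DyckStep) :
    mn (x :: l) = min 0 (rise x + mn l) := rfl

theorem ht_nonneg (l : List DyckStep) : 0 ≤ ht l := by cases l <;> simp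
theorem mn_nonpos (l : List DyckStep) : mn l ≤ 0 := by cases l <;> simp

theorem lev_le_ht (l : List DyckStep) : lev l ≤ ht l := by
  induction l with
  | nil => simp
  | cons x l ih => simp only [lev_cons, ht_cons]; omega

theorem mn_le_lev (l : List DyckStep) : mn l ≤ lev l := by
  induction l with
  | nil => simp
  | cons x l ih => simp only [lev_cons, mn_cons]; omega

@[simp] theorem lev_append (a b : List DyckStep) : lev (a ++ b) = lev a + lev b := by
  induction a with
  | nil => simp
  | cons x l ih => simp only [List.cons_append, lev_cons]; omega

@[simp] theorem ht_append (a b : List DyckStep) : ht (a ++ b) = max (ht a) (lev a + ht b) := by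
  induction a with
  | nil => have := ht_nonneg b; simp [this]
  | cons x l ih => simp only [List.cons_append, lev_cons, ht_cons]; omega

@[simp] theorem mn_append (a b : List DyckStep) : mn (a ++ b) = min (mn a) (lev a + mn b) := by
  induction a with
  | nil => have := mn_nonpos b; simp [this]
  | cons x l ih => simp only [List.cons_append, lev_cons, mn_cons]; omega

theorem lev_eq_count (l : List DyckStep) : lev l = (l.count U : ℤ) - (l.count D : ℤ) := by
  induction l with
  | nil => simp
  | cons x l ih => cases x <;> simp [ih] <;> ring

theorem length_eq_count (l : List DyckStep) : l.length = l.count U + l.count D := by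
  induction l with
  | nil => simp
  | cons x l ih => cases x <;> simp [ih] <;> omega

/-- Bridge from the recursive height to levels of prefixes, the form in which `level` and `maxLevel`
are given. -/
theorem ht_le_iff (l : List DyckStep) (c : ℤ) : ht l ≤ c ↔ ∀ i, lev (l.take i) ≤ c := by
  induction l generalizing c with
  | nil => simp
  | cons x l ih =>
    have key : ht l ≤ c - rise x ↔ ∀ i, lev (l.take i) ≤ c - rise x := ih _
    constructor
    · intro h i
      simp only [ht_cons] at h
      cases i with
      | zero => simp; omega
      | succ i =>
        have := key.1 (by omega) i
        simp only [List.take_succ_cons, lev_cons]; omega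
    · intro h
      have h0 := h 0
      have := key.2 fun i => by
        have := h (i + 1)
        simp only [List.take_succ_cons, lev_cons] at this; omega
      simp only [List.take_zero, lev_nil] at h0
      simp only [ht_cons]; omega

theorem le_mn_iff (l : List DyckStep) (c : ℤ) : c ≤ mn l ↔ ∀ i, c ≤ lev (l.take i) := by
  induction l generalizing c with
  | nil => simp
  | cons x l ih =>
    have key : c - rise x ≤ mn l ↔ ∀ i, c - rise x ≤ lev (l.take i) := ih _
    constructor
    · intro h i
      simp only [mn_cons] at h
      cases i with
      | zero => simp; omega
      | succ i =>
        have := key.1 (by omega) i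
        simp only [List.take_succ_cons, lev_cons]; omega
    · intro h
      have h0 := h 0
      have := key.2 fun i => by
        have := h (i + 1)
        simp only [List.take_succ_cons, lev_cons] at this; omega
      simp only [List.take_zero, lev_nil] at h0
      simp only [mn_cons]; omega

@[simp] theorem wt_nil (k : ℕ) : wt k [] = 0 := by simp [wt]
@[simp] theorem wt_singleton (k : ℕ) (x : DyckStep) : wt k [x] = 0 := by simp [wt]
@[simp] theorem wt_U_cons (k : ℕ) (l : List DyckStep) : wt k (U :: l) = wt (k + 1) l := by
  cases l <;> simp [wt]
@[simp] theorem wt_D_U (k : ℕ) (l : List DyckStep) :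
    wt k (D :: U :: l) = k + wt (k + 1 + 1) l := by
  simp [wt]
@[simp] theorem wt_D_D (k : ℕ) (l : List DyckStep) :
    wt k (D :: D :: l) = wt (k + 1) (D :: l) := by
  simp [wt]

theorem wt_append_U (k : ℕ) (a b : List DyckStep) :
    wt k ((a ++ [U]) ++ b) = wt k (a ++ [U]) + wt (k + a.length + 1) b := by
  induction a generalizing k with
  | nil => simp
  | cons x l ih =>
    have := ih (k + 1)
    rcases x with _ | _
    · simp only [List.cons_append, wt_U_cons, List.length_cons] at this ⊢
      rw [this]; congr 2; omega
    · rcases l with _ | ⟨_ | _, l⟩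
      · simp
      · have := ih (k + 1)
        simp only [List.cons_append, wt_U_cons, wt_D_U, List.length_cons] at this ⊢
        have e : k + 1 + (l.length + 1) = k + (l.length + 1 + 1) := by omega
        rw [e] at this; omega
      · simp only [List.cons_append, wt_D_D, List.length_cons] at this ⊢
        rw [this]; congr 2; omega

theorem wt_append_D_D (k : ℕ) (a b : List DyckStep) :
    wt k (a ++ D :: D :: b) = wt k a + wt (k + a.length + 1) (D :: b) := by
  induction a generalizing k with
  | nil => simp
  | cons x l ih =>
    have := ih (k + 1)
    have e : k + 1 + l.length + 1 = k + (l.length + 1) + 1 := by omega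
    rcases x with _ | _
    · simp only [List.cons_append, wt_U_cons, List.length_cons] at this ⊢
      rw [this, e]
    · rcases l with _ | ⟨_ | _, l⟩
      · simp
      · simp only [List.cons_append, wt_U_cons, wt_D_U, List.length_cons] at this e ⊢
        rw [e] at this; omega
      · simp only [List.cons_append, wt_D_D, List.length_cons] at this e ⊢
        rw [this, e]

theorem wt_append_D_U (k : ℕ) (a b : List DyckStep) :
    wt k (a ++ D :: U :: b) = wt k a + (k + a.length) + wt (k + a.length + 1 + 1) b := by
  induction a generalizing k with
  | nil => simp
  | cons x l ih =>
    have := ih (k + 1)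
    have e : k + 1 + l.length = k + (l.length + 1) := by omega
    rcases x with _ | _
    · simp only [List.cons_append, wt_U_cons, List.length_cons] at this ⊢
      rw [this, e]
    · rcases l with _ | ⟨_ | _, l⟩
      · simp
      · simp only [List.cons_append, wt_U_cons, wt_D_U, List.length_cons] at this e ⊢
        rw [e] at this; omega
      · simp only [List.cons_append, wt_D_D, List.length_cons] at this e ⊢
        rw [this, e]

@[simp] theorem wt_append_singleton_D (k : ℕ) (a : List DyckStep) : wt k (a ++ [D]) = wt k a := by
  induction a generalizing k with
  | nil => simp
  | cons x l ih =>
    have := ih (k + 1)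
    rcases x with _ | _
    · simpa using this
    · rcases l with _ | ⟨_ | _, l⟩
      · simp
      · simpa using this
      · simpa using this

theorem eq_nil_or_append (l : List DyckStep) :
    l = [] ∨ (∃ a, l = a ++ [U]) ∨ ∃ a, l = a ++ [D] := by
  induction l using List.reverseRecOn with
  | nil => simp
  | append_singleton a x => cases x <;> simp

/-- Appending a path that does not start with an up step creates no descent. -/
theorem wt_append_D (k : ℕ) (a b : List DyckStep) :
    wt k (a ++ D :: b) = wt k a + wt (k + a.length) (D :: b) := by
  rcases b with _ | ⟨_ | _, b⟩
  · simp
  · rw [wt_append_D_U]; simp; omega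
  · rw [wt_append_D_D]; simp

theorem wt_append_U_append (k : ℕ) (a b : List DyckStep) :
    wt k (a ++ U :: b) = wt k (a ++ [U]) + wt (k + a.length + 1) b := by
  simpa using wt_append_U k a b

@[simp] theorem wt_append_U_U (k : ℕ) (a : List DyckStep) :
    wt k (a ++ [U, U]) = wt k (a ++ [U]) := by
  rw [show a ++ [U, U] = a ++ U :: [U] from rfl, wt_append_U_append]; simp

/-- Turning the up step that leads to the left-most maximum into a down step does not change
the weights of the descents. -/
theorem wt_flip (k : ℕ) (a b : List DyckStep) (ha : ht a ≤ lev a) (hb : ht b ≤ 0) :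
    wt k (a ++ U :: b) = wt k (a ++ D :: b) := by
  rcases b with _ | ⟨_ | _, b⟩
  · rcases eq_nil_or_append a with rfl | ⟨c, rfl⟩ | ⟨c, rfl⟩
    · simp
    · simpa using (wt_append_singleton_D k (c ++ [U])).symm
    · have := lev_le_ht c
      simp at ha
  · have := ht_nonneg b
    simp at hb; omega
  · rw [wt_append_D, wt_append_U_append]
    rcases eq_nil_or_append a with rfl | ⟨c, rfl⟩ | ⟨c, rfl⟩
    · simp
    · simp
    · have := lev_le_ht c
      simp at ha

/-! ### Cutting a path at maxima, first passages and last visits -/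

theorem exists_leftmost_max (l : List DyckStep) (h : 0 < ht l) :
    ∃ a b, l = a ++ U :: b ∧ ht a ≤ lev a ∧ ht b ≤ 0 := by
  induction l with
  | nil => simp at h
  | cons x l ih =>
    by_cases hl : ht l ≤ 0
    · rcases x with _ | _
      · exact ⟨[], l, rfl, by simp, hl⟩
      · simp at h; omega
    · obtain ⟨a, b, rfl, ha, hb⟩ := ih (by omega)
      refine ⟨x :: a, b, rfl, ?_, hb⟩
      have := lev_le_ht a
      have := ht_nonneg b
      simp at h ⊢
      rcases x with _ | _ <;> simp at h ⊢ <;> omega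

theorem exists_rightmost_max (l : List DyckStep) (h : lev l < ht l) :
    ∃ a b, l = a ++ D :: b ∧ ht a ≤ lev a ∧ ht b ≤ 0 := by
  induction l with
  | nil => simp at h
  | cons x l ih =>
    by_cases hl : lev l < ht l
    · by_cases hx : x = D ∧ ht l ≤ 0
      · obtain ⟨rfl, hx⟩ := hx
        exact ⟨[], l, rfl, by simp, hx⟩
      · obtain ⟨a, b, rfl, ha, hb⟩ := ih hl
        refine ⟨x :: a, b, rfl, ?_, hb⟩
        have := lev_le_ht a
        have := ht_nonneg a
        have := ht_nonneg b
        rcases x with _ | _ <;> simp at h hx ⊢ <;> omega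
    · have := lev_le_ht l
      have := ht_nonneg l
      rcases x with _ | _
      · simp at h; omega
      · refine ⟨[], l, rfl, by simp, ?_⟩
        simp at h; omega

theorem append_cons_cases {x : DyckStep} {a b a' b' : List DyckStep}
    (h : a ++ x :: b = a' ++ x :: b') :
    (a = a' ∧ b = b') ∨ (∃ c, a' = a ++ x :: c ∧ b = c ++ x :: b') ∨
      ∃ c, a = a' ++ x :: c ∧ b' = c ++ x :: b := by
  rcases List.append_eq_append_iff.1 h with ⟨c, h1, h2⟩ | ⟨c, h1, h2⟩
  · rcases c with _ | ⟨y, c⟩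
    · simp at h1 h2; exact Or.inl ⟨h1.symm, h2⟩
    · simp at h2; obtain ⟨rfl, h2⟩ := h2; exact Or.inr (Or.inl ⟨c, h1, h2⟩)
  · rcases c with _ | ⟨y, c⟩
    · simp at h1 h2; exact Or.inl ⟨h1, h2.symm⟩
    · simp at h2; obtain ⟨rfl, h2⟩ := h2; exact Or.inr (Or.inr ⟨c, h1, h2⟩)

/-- The conditions on `a` and `b` do not involve `x`: they single out the step before the left-most
maximum if `x = U`, and the step after the right-most maximum if `x = D`. Hence exchanging the two
letters is invertible. -/
theorem max_decomposition_unique {x : DyckStep} {a b a' b' : List DyckStep}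
    (h : a ++ x :: b = a' ++ x :: b') (ha : ht a ≤ lev a) (hb : ht b ≤ 0)
    (ha' : ht a' ≤ lev a') (hb' : ht b' ≤ 0) : a = a' ∧ b = b' := by
  rcases append_cons_cases h with h | ⟨c, rfl, rfl⟩ | ⟨c, rfl, rfl⟩
  · exact h
  · exfalso
    have := ht_nonneg c
    have := lev_le_ht c
    have := ht_nonneg b'
    rcases x with _ | _ <;>
      simp only [ht_append, lev_append, ht_cons, lev_cons, rise_U, rise_D] at ha hb ha' hb' <;> omega
  · exfalso
    have := ht_nonneg c
    have := lev_le_ht c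
    have := ht_nonneg b
    rcases x with _ | _ <;>
      simp only [ht_append, lev_append, ht_cons, lev_cons, rise_U, rise_D] at ha hb ha' hb' <;> omega

theorem exists_first_passage (l : List DyckStep) (h : mn l < 0) :
    ∃ a b, l = a ++ D :: b ∧ 0 ≤ mn a ∧ lev a = 0 := by
  -- The threshold is generalized because removing the first step shifts the relative level.
  suffices H : ∀ (l : List DyckStep) (c : ℤ), 0 ≤ c → mn l < -c →
      ∃ a b, l = a ++ D :: b ∧ -c ≤ mn a ∧ lev a = -c by
    simpa using H l 0 le_rfl (by simpa using h)
  intro l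
  induction l with
  | nil => intro c hc h; simp at h; omega
  | cons x l ih =>
    intro c hc h
    by_cases hx : x = D ∧ c = 0
    · obtain ⟨rfl, rfl⟩ := hx
      exact ⟨[], l, rfl, by simp, by simp⟩
    · obtain ⟨a, b, rfl, h1, h2⟩ := ih (c + rise x)
        (by rcases x with _ | _ <;> simp at hx ⊢ <;> omega)
        (by rcases x with _ | _ <;> simp at h ⊢ <;> omega)
      refine ⟨x :: a, b, rfl, ?_, ?_⟩
      · rw [mn_cons]; omega
      · rw [lev_cons]; omega

theorem first_passage_unique {a b a' b' : List DyckStep}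
    (h : a ++ D :: b = a' ++ D :: b') (ha : 0 ≤ mn a) (ha0 : lev a = 0)
    (ha' : 0 ≤ mn a') (ha0' : lev a' = 0) : a = a' ∧ b = b' := by
  rcases append_cons_cases h with h | ⟨c, rfl, rfl⟩ | ⟨c, rfl, rfl⟩
  · exact h
  all_goals
    exfalso
    have := mn_nonpos c
    simp at *; omega

theorem exists_last_visit (l : List DyckStep) (c : ℤ) (h : mn l ≤ c) (h' : c < lev l) :
    ∃ a b, l = a ++ U :: b ∧ lev a = c ∧ 0 ≤ mn b := by
  induction l generalizing c with
  | nil => simp at h h'; omega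
  | cons x l ih =>
    by_cases hx : mn l ≤ c - rise x
    · obtain ⟨a, b, rfl, h1, h2⟩ := ih (c - rise x) hx (by simp at h'; omega)
      exact ⟨x :: a, b, rfl, by rw [lev_cons]; omega, h2⟩
    · have := mn_nonpos l
      rcases x with _ | _
      · refine ⟨[], l, rfl, ?_, ?_⟩ <;> simp at * <;> omega
      · simp at *; omega

theorem last_visit_unique {a b a' b' : List DyckStep}
    (h : a ++ U :: b = a' ++ U :: b') (hb : 0 ≤ mn b) (hb' : 0 ≤ mn b')
    (hlev : lev a = lev a') : a = a' ∧ b = b' := by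
  rcases append_cons_cases h with h | ⟨c, rfl, rfl⟩ | ⟨c, rfl, rfl⟩
  · exact h
  all_goals
    exfalso
    simp at *; omega

/-! ### Counting bounded walks by major index -/

/-- The paths with `u` up steps and `d` down steps. -/
def words (u d : ℕ) : Finset (List DyckStep) :=
  (List.replicate u U ++ List.replicate d D).permutations.toFinset

@[simp] theorem mem_words {u d : ℕ} {l : List DyckStep} :
    l ∈ words u d ↔ l.count U = u ∧ l.count D = d := by
  rw [words, List.mem_toFinset, List.mem_permutations, List.perm_iff_count]
  constructor
  · intro h
    have h1 := h U
    have h2 := h D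
    simp [List.count_replicate] at h1 h2
    exact ⟨h1, h2⟩
  · rintro ⟨h1, h2⟩ x
    cases x <;> simp [List.count_replicate, h1, h2]

theorem lev_of_mem_words {u d : ℕ} {l : List DyckStep} (h : l ∈ words u d) :
    lev l = (u : ℤ) - d := by
  rw [mem_words] at h
  rw [lev_eq_count, h.1, h.2]

theorem length_of_mem_words {u d : ℕ} {l : List DyckStep} (h : l ∈ words u d) :
    l.length = u + d := by
  rw [mem_words] at h
  rw [length_eq_count, h.1, h.2]

theorem sum_words_filter_last_D {M : Type*} [AddCommMonoid M] (u d : ℕ) (g : List DyckStep → M) :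
    ∑ w ∈ (words u (d + 1)).filter (fun w => w.getLast? = some D), g w =
      ∑ w ∈ words u d, g (w ++ [D]) := by
  symm
  refine Finset.sum_nbij (fun w => w ++ [D]) ?_ ?_ ?_ (fun _ _ => rfl)
  · intro w hw
    simp at hw ⊢
    exact hw
  · intro a _ b _ h
    simpa using h
  · intro w hw
    rcases eq_nil_or_append w with rfl | ⟨a, rfl⟩ | ⟨a, rfl⟩
    · simp at hw
    · simp at hw
    · simp at hw ⊢
      exact hw

theorem sum_words_filter_last_not_D {M : Type*} [AddCommMonoid M] (u d : ℕ)
    (g : List DyckStep → M) :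
    ∑ w ∈ (words (u + 1) d).filter (fun w => ¬ w.getLast? = some D), g w =
      ∑ w ∈ words u d, g (w ++ [U]) := by
  symm
  refine Finset.sum_nbij (fun w => w ++ [U]) ?_ ?_ ?_ (fun _ _ => rfl)
  · intro w hw
    simp at hw ⊢
    exact hw
  · intro a _ b _ h
    simpa using h
  · intro w hw
    rcases eq_nil_or_append w with rfl | ⟨a, rfl⟩ | ⟨a, rfl⟩
    · simp at hw
    · simp at hw ⊢
      exact hw
    · simp at hw

theorem sum_words_succ_succ {M : Type*} [AddCommMonoid M] (u d : ℕ) (g : List DyckStep → M) :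
    ∑ w ∈ words (u + 1) (d + 1), g w =
      ∑ w ∈ words (u + 1) d, g (w ++ [D]) + ∑ w ∈ words u (d + 1), g (w ++ [U]) := by
  rw [← Finset.sum_filter_add_sum_filter_not _ (fun w : List DyckStep => w.getLast? = some D),
    sum_words_filter_last_D, sum_words_filter_last_not_D]

noncomputable section

/-- The generating function of the major index over the paths with `u` up steps and `d` down
steps that do not go below the level `-c`. -/
def walkSum (u d c : ℕ) : RatFunc ℚ :=
  ∑ w ∈ (words u d).filter (fun w => -(c : ℤ) ≤ mn w), q ^ wt 1 w

theorem walkSum_zero_left {d c : ℕ} (h : d ≤ c) : walkSum 0 d c = 1 := by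
  have hw : words 0 d = {List.replicate d D} := by
    ext l
    simp only [mem_words, Finset.mem_singleton, List.eq_replicate_iff, length_eq_count]
    constructor
    · rintro ⟨h1, h2⟩
      refine ⟨by omega, fun b hb => ?_⟩
      rcases b with _ | _
      · exact absurd hb (List.count_eq_zero.1 h1)
      · rfl
    · rintro ⟨h1, h2⟩
      have : l.count U = 0 := List.count_eq_zero.2 fun hU => by simpa using h2 U hU
      exact ⟨this, by omega⟩
  have hm : ∀ d : ℕ, mn (List.replicate d D) = -d := by
    intro d
    induction d with
    | zero => simp
    | succ d ih => simp only [List.replicate_succ, mn_cons, ih, rise_D]; push_cast; omega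
  have hwt : ∀ d k : ℕ, wt k (List.replicate d D) = 0 := by
    intro d
    induction d with
    | zero => simp
    | succ d ih =>
      intro k
      rw [List.replicate_succ', wt_append_singleton_D, ih]
  rw [walkSum, hw, Finset.filter_true_of_mem (by simp [hm, h])]
  simp [hwt]

theorem walkSum_zero_right (u c : ℕ) : walkSum u 0 c = 1 := by
  have hw : words u 0 = {List.replicate u U} := by
    ext l
    simp only [mem_words, Finset.mem_singleton, List.eq_replicate_iff, length_eq_count]
    constructor
    · rintro ⟨h1, h2⟩
      refine ⟨by omega, fun b hb => ?_⟩
      rcases b with _ | _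
      · rfl
      · exact absurd hb (List.count_eq_zero.1 h2)
    · rintro ⟨h1, h2⟩
      have : l.count D = 0 := List.count_eq_zero.2 fun hU => by simpa using h2 D hU
      exact ⟨by omega, this⟩
  have hm : ∀ d : ℕ, mn (List.replicate d U) = 0 := by
    intro d
    induction d with
    | zero => simp
    | succ d ih => simp only [List.replicate_succ, mn_cons, ih, rise_U]; omega
  have hwt : ∀ d k : ℕ, wt k (List.replicate d U) = 0 := by
    intro d
    induction d with
    | zero => simp
    | succ d ih =>
      intro k
      rw [List.replicate_succ, wt_U_cons, ih]
  rw [walkSum, hw, Finset.filter_true_of_mem (by simp [hm])]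
  simp [hwt]

/-- The walk ends on the boundary level `-c`, so its last step is a down step, which creates no
descent. -/
theorem walkSum_succ_of_eq {u d c : ℕ} (h : d = u + c) :
    walkSum (u + 1) (d + 1) c = walkSum (u + 1) d c := by
  simp only [walkSum, Finset.sum_filter]
  rw [sum_words_succ_succ, Finset.sum_eq_zero (s := words u (d + 1)), add_zero]
  · refine Finset.sum_congr rfl fun w hw => ?_
    have := lev_of_mem_words hw
    simp only [mn_append, mn_cons, mn_nil, rise_D, wt_append_singleton_D]
    congr 1
    push_cast at *
    simp only [eq_iff_iff]
    omega
  · intro w hw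
    have := lev_of_mem_words hw
    have := mn_le_lev w
    rw [if_neg]
    simp only [mn_append]
    push_cast at *
    omega

/-- Remove the last step. A final up step costs `u + d + 1` exactly when a down step precedes it;
the last term corrects for the walks ending in D U, indexed by what remains without both steps. -/
theorem walkSum_succ {u d c : ℕ} (h : d < u + c) :
    walkSum (u + 1) (d + 1) c =
      walkSum (u + 1) d c + walkSum u (d + 1) c + (q ^ (u + d + 1) - 1) * walkSum u d c := by
  have h1 : walkSum u d c = ∑ w ∈ (words u (d + 1)).filter (fun w => w.getLast? = some D),
      if -(c : ℤ) ≤ mn w then q ^ wt 1 w else 0 := by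
    rw [sum_words_filter_last_D]
    simp only [walkSum, Finset.sum_filter]
    refine Finset.sum_congr rfl fun w hw => ?_
    have := lev_of_mem_words hw
    simp only [mn_append, mn_cons, mn_nil, rise_D, wt_append_singleton_D]
    congr 1
    simp only [eq_iff_iff]
    omega
  rw [h1]
  simp only [walkSum, Finset.sum_filter]
  rw [sum_words_succ_succ, add_assoc, Finset.mul_sum, ← Finset.sum_add_distrib]
  congr 1
  · refine Finset.sum_congr rfl fun w hw => ?_
    have := lev_of_mem_words hw
    simp only [mn_append, mn_cons, mn_nil, rise_D, wt_append_singleton_D]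
    congr 1
    push_cast at *
    simp only [eq_iff_iff]
    omega
  · refine Finset.sum_congr rfl fun w hw => ?_
    have hlen := length_of_mem_words hw
    have := mn_le_lev w
    have hm : mn (w ++ [U]) = mn w := by simp; omega
    rw [hm]
    split_ifs with h2 h3
    · rcases eq_nil_or_append w with rfl | ⟨a, rfl⟩ | ⟨a, rfl⟩
      · simp at h3
      · simp at h3
      · have e : wt 1 (a ++ [D] ++ [U]) = wt 1 a + (u + d + 1) := by
          rw [show a ++ [D] ++ [U] = a ++ D :: U :: [] by simp, wt_append_D_U]
          simp at hlen ⊢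
          omega
        rw [e, wt_append_singleton_D, pow_add]; ring
    · rcases eq_nil_or_append w with rfl | ⟨a, rfl⟩ | ⟨a, rfl⟩
      · simp
      · simp
      · simp at h3
    · simp
    · simp

/-! ### Gaussian binomials and the q-reflection principle -/

theorem qInt_ne_zero {r : ℕ} (hr : 1 ≤ r) : qInt r ≠ 0 := by
  have h : qInt r = algebraMap (Polynomial ℚ) (RatFunc ℚ)
      (∑ i ∈ Finset.range r, Polynomial.X ^ i) := by
    simp [qInt, RatFunc.algebraMap_X]
  rw [h]
  refine RatFunc.algebraMap_ne_zero fun h0 => ?_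
  have := congrArg (Polynomial.eval 1) h0
  simp [Polynomial.eval_finsetSum] at this
  omega

@[simp] theorem qInt_zero : qInt 0 = 0 := by simp [qInt]

theorem qInt_add (a b : ℕ) : qInt (a + b) = qInt a + q ^ a * qInt b := by
  simp [qInt, Finset.sum_range_add, Finset.mul_sum, pow_add]

theorem qInt_mul (r : ℕ) : (q - 1) * qInt r = q ^ r - 1 := mul_geom_sum q r

@[simp] theorem qFactorial_zero : qFactorial 0 = 1 := by simp [qFactorial]

theorem qFactorial_succ (n : ℕ) : qFactorial (n + 1) = qFactorial n * qInt (n + 1) := by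
  rw [qFactorial, qFactorial, Finset.prod_Icc_succ_top (by omega)]

theorem qFactorial_ne_zero (n : ℕ) : qFactorial n ≠ 0 :=
  Finset.prod_ne_zero_iff.2 fun _ hr => qInt_ne_zero (Finset.mem_Icc.1 hr).1

/-- The Gaussian binomial coefficient `[u + d]! / ([u]! [d]!)`. -/
def gauss (u d : ℕ) : RatFunc ℚ := qFactorial (u + d) / (qFactorial u * qFactorial d)

theorem gauss_comm (u d : ℕ) : gauss u d = gauss d u := by
  rw [gauss, gauss, add_comm, mul_comm]

@[simp] theorem gauss_zero_right (u : ℕ) : gauss u 0 = 1 := by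
  simp [gauss, qFactorial_ne_zero]

@[simp] theorem gauss_zero_left (u : ℕ) : gauss 0 u = 1 := by
  rw [gauss_comm, gauss_zero_right]

theorem gauss_succ (u d : ℕ) :
    gauss (u + 1) (d + 1) = gauss (u + 1) d + q ^ (d + 1) * gauss u (d + 1) := by
  have e : u + 1 + (d + 1) = (u + d + 1) + 1 := by omega
  have h : qInt (u + d + 1 + 1) = qInt (d + 1) + q ^ (d + 1) * qInt (u + 1) := by
    rw [← qInt_add]; congr 1; omega
  simp only [gauss, e, show u + 1 + d = u + d + 1 by omega, show u + (d + 1) = u + d + 1 by omega,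
    qFactorial_succ _, h]
  have h1 := qFactorial_ne_zero u
  have h2 := qFactorial_ne_zero d
  have h3 := qInt_ne_zero (r := u + 1) (by omega)
  have h4 := qInt_ne_zero (r := d + 1) (by omega)
  field_simp

theorem gauss_succ' (u d : ℕ) :
    gauss (u + 1) (d + 1) = gauss u (d + 1) + q ^ (u + 1) * gauss (u + 1) d := by
  rw [gauss_comm, gauss_succ, gauss_comm (d + 1), gauss_comm d]

theorem gauss_succ_mul (u d : ℕ) :
    gauss u (d + 1) * qInt (d + 1) = gauss u d * qInt (u + d + 1) := by
  simp only [gauss, ← add_assoc, qFactorial_succ _]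
  have h1 := qFactorial_ne_zero u
  have h2 := qFactorial_ne_zero d
  have h4 := qInt_ne_zero (r := d + 1) (by omega)
  field_simp

/-- The interior recursion of `walkSum_succ`, obtained from q-Pascal by writing `q ^ (d + 1)` as `1
+ (q - 1) * qInt (d + 1)`. -/
theorem gauss_succ_succ (u d : ℕ) :
    gauss (u + 1) (d + 1) =
      gauss (u + 1) d + gauss u (d + 1) + (q ^ (u + d + 1) - 1) * gauss u d := by
  rw [gauss_succ, ← qInt_mul]
  linear_combination (q - 1) * gauss_succ_mul u d - gauss u (d + 1) * qInt_mul (d + 1)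

/-- The correction term of the reflection principle. -/
def reflectedGauss (u d c : ℕ) : RatFunc ℚ :=
  if c + 1 ≤ d then q ^ (c + 1) * gauss (u + c + 1) (d - (c + 1)) else 0

/-- Both sides obey the same recursion in the interior and on the boundary, with the same initial
values. -/
theorem walkSum_eq (u d c : ℕ) (h : d ≤ u + c) :
    walkSum u d c = gauss u d - reflectedGauss u d c := by
  induction u generalizing d with
  | zero =>
    rw [walkSum_zero_left (by omega), reflectedGauss, if_neg (by omega)]; simp
  | succ u ihu =>
    induction d with
    | zero => rw [walkSum_zero_right, reflectedGauss, if_neg (by omega)]; simp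
    | succ d ihd =>
      rcases Nat.lt_or_ge d (u + c) with hlt | hge
      · rw [walkSum_succ hlt, ihd (by omega), ihu (d + 1) (by omega), ihu d (by omega),
          gauss_succ_succ]
        -- Reflection preserves the number of steps, so the coefficient `q ^ (u + d + 1) - 1` is the
        -- same for the reflected term.
        have key : reflectedGauss (u + 1) (d + 1) c = reflectedGauss (u + 1) d c +
            reflectedGauss u (d + 1) c + (q ^ (u + d + 1) - 1) * reflectedGauss u d c := by
          rcases Nat.lt_trichotomy d c with h1 | h1 | h1
          · simp [reflectedGauss, show ¬ c ≤ d by omega, show ¬ c + 1 ≤ d by omega]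
          · subst h1
            simp [reflectedGauss]
          · obtain ⟨e, rfl⟩ := Nat.exists_eq_add_of_lt h1
            have e1 : c + e + 1 - (c + 1) = e := by omega
            have e2 : c + e + 1 + 1 - (c + 1) = e + 1 := by omega
            have := gauss_succ_succ (u + c + 1) e
            simp only [reflectedGauss, e1, e2, show c + 1 ≤ c + e + 1 by omega,
              show c + 1 ≤ c + e + 1 + 1 by omega, if_true,
              show u + 1 + c + 1 = u + c + 1 + 1 by omega,
              show u + (c + e + 1) + 1 = u + c + 1 + e + 1 by omega]
            rw [this]; ring
        rw [key]; ring
      -- On the boundary, the q-Pascal increments of the main and reflected terms agree by the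
      -- symmetry of `gauss`.
      · have hd : d = u + c := by omega
        rw [walkSum_succ_of_eq hd, ihd (by omega)]
        subst hd
        have h1 := gauss_succ u (u + c)
        rcases u with _ | u
        · simp [reflectedGauss] at h1 ⊢
          rw [h1]; ring
        · have h3 := gauss_comm (u + 1) (u + 1 + c + 1)
          simp only [reflectedGauss, show c + 1 ≤ u + 1 + c by omega,
            show c + 1 ≤ u + 1 + c + 1 by omega, if_true,
            show u + 1 + c - (c + 1) = u by omega, show u + 1 + c + 1 - (c + 1) = u + 1 by omega,
            show u + 1 + 1 + c + 1 = u + c + 2 + 1 by omega]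
          have h2' := gauss_succ (u + c + 2) u
          rw [h1, h2', h3]
          simp only [show u + 1 + c + 1 = u + c + 2 by omega]
          have e : q ^ (u + c + 2) = q ^ (c + 1) * q ^ (u + 1) := by
            rw [← pow_add]; congr 1; omega
          rw [e]; ring

end

/-! ### Catalan paths, pairs of them, and the flips -/

theorem mem_words_iff {u d : ℕ} {l : List DyckStep} :
    l ∈ words u d ↔ lev l = (u : ℤ) - d ∧ l.length = u + d := by
  rw [mem_words, lev_eq_count, length_eq_count]
  omega

/-- The paths with `n` up steps and `n` down steps that never go below level zero. -/
def dyck (n : ℕ) : Finset (List DyckStep) := (words n n).filter fun l => 0 ≤ mn l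

theorem mem_dyck {n : ℕ} {l : List DyckStep} :
    l ∈ dyck n ↔ 0 ≤ mn l ∧ lev l = 0 ∧ l.length = 2 * n := by
  rw [dyck, Finset.mem_filter, mem_words_iff]
  omega

/-- The pairs of Catalan paths of total length `2 * n`. -/
def dyckPairs (n : ℕ) : Finset (List DyckStep × List DyckStep) :=
  (Finset.HasAntidiagonal.antidiagonal n).biUnion fun a => dyck a.1 ×ˢ dyck a.2

theorem mem_dyckPairs {n : ℕ} {p : List DyckStep × List DyckStep} :
    p ∈ dyckPairs n ↔ 0 ≤ mn p.1 ∧ lev p.1 = 0 ∧ 0 ≤ mn p.2 ∧ lev p.2 = 0 ∧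
      p.1.length + p.2.length = 2 * n := by
  simp only [dyckPairs, Finset.mem_biUnion, Finset.HasAntidiagonal.mem_antidiagonal, Finset.mem_product, mem_dyck]
  constructor
  · rintro ⟨a, h, h1, h2⟩
    omega
  · rintro ⟨h1, h2, h3, h4, h5⟩
    have e1 := length_eq_count p.1
    have e2 := length_eq_count p.2
    rw [lev_eq_count] at h2 h4
    refine ⟨(p.1.count U, p.2.count U), ?_, ⟨h1, ?_, ?_⟩, h3, ?_, ?_⟩
    all_goals (try rw [lev_eq_count]); try simp only
    all_goals omega

theorem exists_eq_U_cons {l : List DyckStep} (h : 0 ≤ mn l) (hl : l ≠ []) : ∃ l', l = U :: l' := by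
  rcases l with _ | ⟨_ | _, l⟩
  · exact absurd rfl hl
  · exact ⟨l, rfl⟩
  · have := mn_nonpos l
    simp at h; omega

theorem exists_eq_append_D {l : List DyckStep} (h : 0 ≤ mn l) (h0 : lev l = 0) (hl : l ≠ []) :
    ∃ l', l = l' ++ [D] := by
  rcases eq_nil_or_append l with rfl | ⟨a, rfl⟩ | ⟨a, rfl⟩
  · exact absurd rfl hl
  · have := mn_le_lev a
    simp at h h0; omega
  · exact ⟨a, rfl⟩

theorem one_le_ht {l : List DyckStep} (h : 0 ≤ mn l) (hl : l ≠ []) : 1 ≤ ht l := by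
  obtain ⟨l', rfl⟩ := exists_eq_U_cons h hl
  have := ht_nonneg l'
  simp; omega

noncomputable section

open Classical in
/-- Turn the step after the right-most maximum into an up step. -/
def flipUp (l : List DyckStep) : List DyckStep :=
  if h : ∃ p : List DyckStep × List DyckStep, l = p.1 ++ D :: p.2 ∧ ht p.1 ≤ lev p.1 ∧ ht p.2 ≤ 0
  then h.choose.1 ++ U :: h.choose.2 else l

open Classical in
/-- Turn the step before the left-most maximum into a down step. -/
def flipDown (l : List DyckStep) : List DyckStep :=
  if h : ∃ p : List DyckStep × List DyckStep, l = p.1 ++ U :: p.2 ∧ ht p.1 ≤ lev p.1 ∧ ht p.2 ≤ 0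
  then h.choose.1 ++ D :: h.choose.2 else l

theorem flipUp_eq {a b : List DyckStep} (ha : ht a ≤ lev a) (hb : ht b ≤ 0) :
    flipUp (a ++ D :: b) = a ++ U :: b := by
  have h : ∃ p : List DyckStep × List DyckStep,
      a ++ D :: b = p.1 ++ D :: p.2 ∧ ht p.1 ≤ lev p.1 ∧ ht p.2 ≤ 0 := ⟨(a, b), rfl, ha, hb⟩
  rw [flipUp, dif_pos h]
  obtain ⟨h1, h2, h3⟩ := h.choose_spec
  obtain ⟨e1, e2⟩ := max_decomposition_unique h1 ha hb h2 h3
  rw [← e1, ← e2]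

theorem flipDown_eq {a b : List DyckStep} (ha : ht a ≤ lev a) (hb : ht b ≤ 0) :
    flipDown (a ++ U :: b) = a ++ D :: b := by
  have h : ∃ p : List DyckStep × List DyckStep,
      a ++ U :: b = p.1 ++ U :: p.2 ∧ ht p.1 ≤ lev p.1 ∧ ht p.2 ≤ 0 := ⟨(a, b), rfl, ha, hb⟩
  rw [flipDown, dif_pos h]
  obtain ⟨h1, h2, h3⟩ := h.choose_spec
  obtain ⟨e1, e2⟩ := max_decomposition_unique h1 ha hb h2 h3
  rw [← e1, ← e2]

theorem wt_flipUp (k : ℕ) {l : List DyckStep} (h : lev l < ht l) : wt k (flipUp l) = wt k l := by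
  obtain ⟨a, b, rfl, ha, hb⟩ := exists_rightmost_max l h
  rw [flipUp_eq ha hb, wt_flip k a b ha hb]

theorem wt_flipDown (k : ℕ) {l : List DyckStep} (h : 0 < ht l) :
    wt k (flipDown l) = wt k l := by
  obtain ⟨a, b, rfl, ha, hb⟩ := exists_leftmost_max l h
  rw [flipDown_eq ha hb, wt_flip k a b ha hb]

theorem flipUp_injective {l l' : List DyckStep} (h : lev l < ht l) (h' : lev l' < ht l')
    (e : flipUp l = flipUp l') : l = l' := by
  obtain ⟨a, b, rfl, ha, hb⟩ := exists_rightmost_max l h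
  obtain ⟨a', b', rfl, ha', hb'⟩ := exists_rightmost_max l' h'
  rw [flipUp_eq ha hb, flipUp_eq ha' hb'] at e
  obtain ⟨rfl, rfl⟩ := max_decomposition_unique e ha hb ha' hb'
  rfl

theorem flipDown_injective {l l' : List DyckStep} (h : 0 < ht l) (h' : 0 < ht l')
    (e : flipDown l = flipDown l') : l = l' := by
  obtain ⟨a, b, rfl, ha, hb⟩ := exists_leftmost_max l h
  obtain ⟨a', b', rfl, ha', hb'⟩ := exists_leftmost_max l' h'
  rw [flipDown_eq ha hb, flipDown_eq ha' hb'] at e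
  obtain ⟨rfl, rfl⟩ := max_decomposition_unique e ha hb ha' hb'
  rfl

/-- Deleting the initial up step lowers the floor to `-1` and replaces `wt 0` by `wt 1`. -/
theorem sum_dyck_succ (n : ℕ) : ∑ l ∈ dyck (n + 1), q ^ wt 0 l = walkSum n (n + 1) 1 := by
  symm
  refine Finset.sum_nbij (fun l => U :: l) ?_ ?_ ?_ ?_
  · intro l hl
    rw [Finset.mem_filter, mem_words_iff] at hl
    rw [mem_dyck, mn_cons, lev_cons, List.length_cons, rise_U]
    push_cast at hl
    omega
  · intro a _ b _ h
    simpa using h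
  · intro l hl
    rw [Finset.mem_coe, mem_dyck] at hl
    obtain ⟨l', rfl⟩ := exists_eq_U_cons hl.1 (by rintro rfl; simp at hl)
    refine ⟨l', ?_, rfl⟩
    rw [mn_cons, lev_cons, List.length_cons, rise_U] at hl
    rw [Finset.mem_coe, Finset.mem_filter, mem_words_iff]
    push_cast
    omega
  · intro l _
    simp

/-- A Catalan path corresponds to a pair of Catalan paths the second of which is at most one
higher than the first: turn the step before the left-most maximum into a down step. -/
theorem sum_dyck_eq_sum_dyckPairs {n : ℕ} (hn : 1 ≤ n) :
    ∑ l ∈ dyck n, q ^ wt 0 l =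
      ∑ p ∈ (dyckPairs n).filter (fun p => p.2 ≠ [] ∧ ht p.2 ≤ ht p.1 + 1),
        q ^ wt 0 (p.1 ++ D :: p.2.tail) := by
  have lt : ∀ p ∈ (dyckPairs n).filter (fun p => p.2 ≠ [] ∧ ht p.2 ≤ ht p.1 + 1),
      lev (p.1 ++ D :: p.2.tail) < ht (p.1 ++ D :: p.2.tail) := by
    rintro ⟨E, F⟩ hp
    simp only [Finset.mem_filter, mem_dyckPairs] at hp
    obtain ⟨⟨h1, h2, h3, h4, h5⟩, h6, h7⟩ := hp
    obtain ⟨F, rfl⟩ := exists_eq_U_cons h3 h6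
    have := ht_nonneg E
    simp at h4 ⊢
    omega
  symm
  refine Finset.sum_nbij (fun p => flipUp (p.1 ++ D :: p.2.tail)) ?_ ?_ ?_ ?_
  · intro p hp
    obtain ⟨a, b, e, ha, hb⟩ := exists_rightmost_max _ (lt p hp)
    obtain ⟨E, F⟩ := p
    simp only [Finset.mem_filter, mem_dyckPairs] at hp
    obtain ⟨⟨h1, h2, h3, h4, h5⟩, h6, h7⟩ := hp
    obtain ⟨F, rfl⟩ := exists_eq_U_cons h3 h6
    simp only [List.tail_cons] at e ⊢
    rw [e, flipUp_eq ha hb, mem_dyck]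
    simp only [mn_cons, lev_cons, ht_cons, List.length_cons, rise_U] at h3 h4 h5 h7
    -- The flipped step is the first passage to `-1`, or comes after it, or lies inside `E`. The
    -- second case would make `F` at least two higher than `E`; in the others everything from the
    -- first passage on is raised by two.
    rcases append_cons_cases e with ⟨rfl, rfl⟩ | ⟨c, rfl, rfl⟩ | ⟨c, rfl, rfl⟩
    · simp only [mn_append, lev_append, mn_cons, lev_cons, List.length_append, List.length_cons,
        rise_U]
      omega
    · exfalso
      have := ht_nonneg b
      have := lev_le_ht c
      simp only [ht_append, lev_append, ht_cons, lev_cons, rise_D] at ha h7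
      omega
    · simp only [mn_append, lev_append, ht_append, mn_cons, lev_cons, ht_cons, List.length_append,
        List.length_cons, rise_U, rise_D] at *
      omega
  · intro p hp p' hp' e
    have := flipUp_injective (lt p hp) (lt p' hp') e
    obtain ⟨E, F⟩ := p
    obtain ⟨E', F'⟩ := p'
    simp only [Finset.mem_coe, Finset.mem_filter, mem_dyckPairs] at hp hp'
    obtain ⟨⟨h1, h2, h3, h4, h5⟩, h6, h7⟩ := hp
    obtain ⟨⟨h1', h2', h3', h4', h5'⟩, h6', h7'⟩ := hp'
    obtain ⟨F, rfl⟩ := exists_eq_U_cons h3 h6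
    obtain ⟨F', rfl⟩ := exists_eq_U_cons h3' h6'
    obtain ⟨rfl, e2⟩ := first_passage_unique this h1 h2 h1' h2'
    simp at e2
    rw [e2]
  · intro l hl
    rw [Finset.mem_coe, mem_dyck] at hl
    have hne : l ≠ [] := by rintro rfl; simp at hl; omega
    obtain ⟨a, b, rfl, ha, hb⟩ :=
      exists_leftmost_max l (by have := one_le_ht hl.1 hne; omega)
    obtain ⟨E, F, e, hE, hE0⟩ := exists_first_passage (a ++ D :: b) (by
      have := mn_le_lev (a ++ D :: b)
      simp only [lev_append, lev_cons, rise_U, rise_D] at *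
      omega)
    refine ⟨(E, U :: F), ?_, by simp only [List.tail_cons]; rw [← e, flipUp_eq ha hb]⟩
    have e1 := congrArg mn e
    have e2 := congrArg lev e
    have e3 := congrArg List.length e
    rw [Finset.mem_coe, Finset.mem_filter, mem_dyckPairs]
    simp only [mn_append, lev_append, mn_cons, lev_cons, List.length_append,
        List.length_cons, rise_U, rise_D] at hl e1 e2 e3 ⊢
    refine ⟨by omega, by simp, ?_⟩
    rcases append_cons_cases e with ⟨rfl, rfl⟩ | ⟨c, rfl, rfl⟩ | ⟨c, rfl, rfl⟩
    · have := ht_nonneg a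
      simp only [ht_cons, rise_U]; omega
    · have := lev_le_ht a
      simp only [mn_append, lev_append, ht_append, mn_cons, lev_cons, ht_cons, rise_U,
        rise_D] at *
      omega
    · have := mn_nonpos c
      simp only [mn_append, lev_append, mn_cons, lev_cons, rise_D] at hl
      omega
  · intro p hp
    simp only [wt_flipUp 0 (lt p hp)]

/-- The path goes through the last point at level one before the right-most maximum, and it
rises by at least three from the maximum before this point to the maximum after it. -/
def IsSteep (l : List DyckStep) : Prop :=
  ∃ P A B, l = (P ++ U :: A) ++ D :: B ∧ lev P = 1 ∧ 0 ≤ mn A ∧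
    ht (P ++ U :: A) ≤ lev (P ++ U :: A) ∧ ht B ≤ 0 ∧ ht P + 3 ≤ lev (P ++ U :: A)

/-- The pairs of Catalan paths with nonempty first component the second of which is at least two
higher than the first. -/
def steepPairs (n : ℕ) : Finset (List DyckStep × List DyckStep) :=
  (dyckPairs n).filter fun p => p.1 ≠ [] ∧ ht p.1 + 2 ≤ ht p.2

theorem mem_steepPairs {n : ℕ} {E F : List DyckStep} :
    (E, F) ∈ steepPairs n ↔ (0 ≤ mn E ∧ lev E = 0 ∧ 0 ≤ mn F ∧ lev F = 0 ∧
      E.length + F.length = 2 * n) ∧ E ≠ [] ∧ ht E + 2 ≤ ht F := by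
  rw [steepPairs, Finset.mem_filter, mem_dyckPairs]

-- With E = P D, the path P U F reaches level two at the start of F and ends there. Flipping at its
-- left-most maximum, which lies in F, brings the end down to level zero; the end of P becomes X and
-- the new maximum is ht F + 1, so the gap of two between heights becomes a gap of three.
open Classical in
theorem sum_isSteep (n : ℕ) :
    ∑ l ∈ (dyck n).filter IsSteep, q ^ wt 0 l =
      ∑ p ∈ steepPairs n, q ^ wt 0 (p.1.dropLast ++ U :: p.2) := by
  have pos : ∀ p ∈ steepPairs n, 0 < ht (p.1.dropLast ++ U :: p.2) := by
    rintro ⟨E, F⟩ hp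
    obtain ⟨⟨h1, h2, h3, h4, h5⟩, h6, h7⟩ := mem_steepPairs.1 hp
    obtain ⟨P, rfl⟩ := exists_eq_append_D h1 h2 h6
    have := ht_nonneg F
    simp only [lev_append, lev_cons, lev_nil, rise_D] at h2
    simp only [List.dropLast_concat, ht_append, ht_cons, rise_U]
    omega
  symm
  refine Finset.sum_nbij (fun p => flipDown (p.1.dropLast ++ U :: p.2)) ?_ ?_ ?_ ?_
  · rintro ⟨E, F⟩ hp
    obtain ⟨⟨h1, h2, h3, h4, h5⟩, h6, h7⟩ := mem_steepPairs.1 hp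
    obtain ⟨P, rfl⟩ := exists_eq_append_D h1 h2 h6
    have := ht_nonneg (P ++ [D])
    obtain ⟨a, b, rfl, ha, hb⟩ := exists_leftmost_max F (by omega)
    have := lev_le_ht P
    have ha' : ht (P ++ U :: a) ≤ lev (P ++ U :: a) := by
      simp only [mn_append, lev_append, ht_append, mn_cons, lev_cons, ht_cons, lev_nil, ht_nil,
        mn_nil, rise_U, rise_D] at *
      omega
    have e : P ++ U :: (a ++ U :: b) = (P ++ U :: a) ++ U :: b := by simp
    simp only [List.dropLast_concat]
    rw [e, flipDown_eq ha' hb, Finset.mem_filter, mem_dyck]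
    refine ⟨?_, P, a, b, rfl, ?_, ?_, ha', hb, ?_⟩
    all_goals
      simp only [mn_append, lev_append, ht_append, mn_cons, lev_cons, ht_cons, lev_nil, ht_nil,
        mn_nil, rise_U, rise_D, List.length_append, List.length_cons, List.length_nil] at *
      omega
  · intro p hp p' hp' e
    have e' := flipDown_injective (pos p hp) (pos p' hp') e
    obtain ⟨E, F⟩ := p
    obtain ⟨E', F'⟩ := p'
    obtain ⟨⟨h1, h2, h3, h4, h5⟩, h6, h7⟩ := mem_steepPairs.1 hp
    obtain ⟨⟨h1', h2', h3', h4', h5'⟩, h6', h7'⟩ := mem_steepPairs.1 hp'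
    obtain ⟨P, rfl⟩ := exists_eq_append_D h1 h2 h6
    obtain ⟨P', rfl⟩ := exists_eq_append_D h1' h2' h6'
    simp only [List.dropLast_concat] at e'
    simp only [lev_append] at h2 h2'
    obtain ⟨rfl, rfl⟩ := last_visit_unique e' h3 h3' (by omega)
    rfl
  · intro l hl
    rw [Finset.mem_coe, Finset.mem_filter, mem_dyck] at hl
    obtain ⟨hl, P, A, B, rfl, h1, h2, h3, h4, h5⟩ := hl
    refine ⟨(P ++ [D], A ++ U :: B), ?_, ?_⟩
    · rw [Finset.mem_coe, mem_steepPairs]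
      have := lev_le_ht P
      have := ht_nonneg B
      refine ⟨?_, by simp, ?_⟩
      all_goals
        simp only [mn_append, lev_append, ht_append, mn_cons, lev_cons, ht_cons, lev_nil, ht_nil,
          mn_nil, rise_U, rise_D, List.length_append, List.length_cons, List.length_nil] at *
        omega
    · simp only [List.dropLast_concat]
      rw [show P ++ U :: (A ++ U :: B) = (P ++ U :: A) ++ U :: B by simp, flipDown_eq h3 h4]
  · intro p hp
    simp only [wt_flipDown 0 (pos p hp)]

end

/-! ### Comparing the two weights of a pair -/

noncomputable section

/-- The weight of a pair of paths, the second of which starts where the first ends. -/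
def pairWt (p : List DyckStep × List DyckStep) : ℕ := wt 0 p.1 + wt p.1.length p.2

/-- Replacing the last D of `E` by U creates a descent, of weight `E.length - 2`, exactly when the
step before it is also D. -/
theorem wt_dropLast_U {E F : List DyckStep} (h : 0 ≤ mn E) (h0 : lev E = 0) (hE : E ≠ []) :
    wt 0 (E.dropLast ++ U :: F) + 2 =
      pairWt (E, F) + if [U, D] <:+ E then 2 else E.length := by
  obtain ⟨P, rfl⟩ := exists_eq_append_D h h0 hE
  rw [pairWt, List.dropLast_concat, wt_append_U_append, wt_append_singleton_D]
  rcases eq_nil_or_append P with rfl | ⟨a, rfl⟩ | ⟨a, rfl⟩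
  · simp at h
  · rw [if_pos ⟨a, by simp⟩]
    simp
  · rw [if_neg]
    · have e : a.length + 1 + 1 = a.length + 2 := rfl
      simp only [wt_append_D_U, wt_append_singleton_D, List.append_assoc, List.cons_append,
        List.nil_append, List.length_append, List.length_cons, List.length_nil, wt_nil, zero_add, e]
      omega
    · rintro ⟨c, hc⟩
      have : c ++ [U] = a ++ [D] :=
        List.append_cancel_right (bs := [D]) (by simpa using hc)
      have := congrArg List.getLast? this
      simp at this

/-- Replacing the first U of `F` by D creates a descent, of weight `E.length`, exactly when the next
step is U. -/
theorem wt_append_D_tail {E F : List DyckStep} (h : 0 ≤ mn F) (hF : F ≠ []) (h0 : lev F = 0) :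
    wt 0 (E ++ D :: F.tail) = pairWt (E, F) + if [U, D] <+: F then 0 else E.length := by
  obtain ⟨F, rfl⟩ := exists_eq_U_cons h hF
  simp only [pairWt, List.tail_cons, wt_append_D, zero_add, wt_U_cons]
  rcases F with _ | ⟨_ | _, F⟩
  · simp at h0
  · rw [if_neg (by simp), wt_D_U, wt_U_cons]; omega
  · rw [if_pos (by simp), wt_D_D]; omega

/-- `pairWt` ignores a descent at the junction: on the left the D before the peak counts, at
`E.length - 1`; on the right the D of the peak counts, at `E.length + 1`. -/
theorem pairWt_append_UD {E F : List DyckStep} (h : 0 ≤ mn E) (h0 : lev E = 0) (hE : E ≠ [])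
    (hF : 0 ≤ mn F) (hF' : F ≠ []) :
    pairWt (E ++ [U, D], F) + 2 = pairWt (E, U :: D :: F) := by
  obtain ⟨P, rfl⟩ := exists_eq_append_D h h0 hE
  obtain ⟨F, rfl⟩ := exists_eq_U_cons hF hF'
  have e : P ++ [D] ++ [U, D] = (P ++ D :: U :: []) ++ [D] := by simp
  simp only [pairWt]
  rw [e, wt_append_singleton_D, wt_append_D_U, wt_append_singleton_D]
  simp only [wt_U_cons, wt_D_U, List.length_append, List.length_cons, List.length_nil, wt_nil,
    zero_add, add_assoc]
  simp only [Nat.reduceAdd]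
  omega

theorem ht_append_UD {E : List DyckStep} (h : 0 ≤ mn E) (h0 : lev E = 0) (hE : E ≠ []) :
    ht (E ++ [U, D]) = ht E := by
  have := one_le_ht h hE
  simp only [ht_append, h0, ht_cons, ht_nil, rise_U, rise_D]
  omega

/-- Moving a final peak of the first path to the beginning of the second path. -/
theorem sum_move_peak (n : ℕ) :
    ∑ p ∈ (steepPairs n).filter (fun p => [U, D] <:+ p.1),
        q ^ pairWt p * (q ^ p.1.length - q ^ 2) =
      ∑ p ∈ (steepPairs n).filter (fun p => [U, D] <+: p.2),
        q ^ pairWt p * (q ^ p.1.length - 1) := by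
  -- Moving the peak would empty a first path `[U, D]`, but there the factor `q ^ 2 - q ^ 2`
  -- vanishes.
  rw [← Finset.sum_filter_of_ne (p := fun p => p.1 ≠ [U, D])]
  swap
  · rintro p _ h h'
    simp [h'] at h
  symm
  refine Finset.sum_nbij (fun p => (p.1 ++ [U, D], p.2.tail.tail)) ?_ ?_ ?_ ?_
  · rintro ⟨E, F⟩ hp
    simp only [Finset.mem_filter, mem_steepPairs] at hp ⊢
    obtain ⟨⟨⟨h1, h2, h3, h4, h5⟩, h6, h7⟩, F, rfl⟩ := hp
    have := one_le_ht h1 h6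
    rw [ht_append_UD h1 h2 h6]
    refine ⟨⟨⟨⟨?_, ?_, ?_, ?_, ?_⟩, by simp, ?_⟩, ⟨E, rfl⟩⟩, by simpa using h6⟩
    all_goals
      simp only [List.cons_append, List.nil_append, List.tail_cons, mn_append, lev_append, mn_cons,
        lev_cons, ht_cons, lev_nil, mn_nil, rise_U, rise_D, List.length_append,
        List.length_cons, List.length_nil] at *
      omega
  · rintro ⟨E, F⟩ hp ⟨E', F'⟩ hp' e
    simp only [Finset.mem_coe, Finset.mem_filter] at hp hp'
    obtain ⟨-, F, rfl⟩ := hp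
    obtain ⟨-, F', rfl⟩ := hp'
    simpa using e
  · rintro ⟨E, F⟩ hp
    simp only [Finset.mem_coe, Finset.mem_filter, mem_steepPairs] at hp
    obtain ⟨⟨⟨⟨h1, h2, h3, h4, h5⟩, h6, h7⟩, E, rfl⟩, h8⟩ := hp
    have hE : E ≠ [] := by rintro rfl; simp at h8
    have h0 : lev E = 0 := by simpa using h2
    have h0' : 0 ≤ mn E := by simp only [mn_append] at h1; omega
    rw [ht_append_UD h0' h0 hE] at h7
    refine ⟨(E, U :: D :: F), ?_, by simp⟩
    simp only [Finset.mem_coe, Finset.mem_filter, mem_steepPairs]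
    refine ⟨⟨⟨h0', h0, ?_, ?_, ?_⟩, hE, ?_⟩, ⟨F, rfl⟩⟩
    all_goals
      simp only [mn_cons, lev_cons, ht_cons, rise_U, rise_D, List.length_append,
        List.length_cons, List.length_nil] at *
      omega
  · rintro ⟨E, F⟩ hp
    simp only [Finset.mem_filter, mem_steepPairs] at hp
    obtain ⟨⟨⟨h1, h2, h3, h4, h5⟩, h6, h7⟩, F, rfl⟩ := hp
    have hF : F ≠ [] := by
      rintro rfl
      have := one_le_ht h1 h6
      simp at h7; omega
    simp only [List.cons_append, List.nil_append, List.tail_cons] at *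
    rw [← pairWt_append_UD h1 h2 h6 (by simp at h3; omega) hF]
    simp only [List.length_append, List.length_cons, List.length_nil, pow_add]
    ring

theorem q_sq_mul_sum_steepPairs (n : ℕ) :
    q ^ 2 * ∑ p ∈ steepPairs n, q ^ wt 0 (p.1.dropLast ++ U :: p.2) =
      ∑ p ∈ steepPairs n, q ^ wt 0 (p.1 ++ D :: p.2.tail) := by
  have h := sum_move_peak n
  rw [Finset.sum_filter, Finset.sum_filter] at h
  rw [Finset.mul_sum]
  calc _ = ∑ p ∈ steepPairs n, (q ^ pairWt p * q ^ p.1.length -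
        if [U, D] <:+ p.1 then q ^ pairWt p * (q ^ p.1.length - q ^ 2) else 0) := by
        refine Finset.sum_congr rfl fun ⟨E, F⟩ hp => ?_
        obtain ⟨⟨h1, h2, h3, h4, h5⟩, h6, h7⟩ := mem_steepPairs.1 hp
        rw [← pow_add, add_comm, wt_dropLast_U h1 h2 h6]
        split_ifs <;> rw [pow_add] <;> ring
    _ = ∑ p ∈ steepPairs n, (q ^ pairWt p * q ^ p.1.length -
        if [U, D] <+: p.2 then q ^ pairWt p * (q ^ p.1.length - 1) else 0) := by
        rw [Finset.sum_sub_distrib, Finset.sum_sub_distrib, h]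
    _ = _ := by
        refine Finset.sum_congr rfl fun ⟨E, F⟩ hp => ?_
        obtain ⟨⟨h1, h2, h3, h4, h5⟩, h6, h7⟩ := mem_steepPairs.1 hp
        have hF : F ≠ [] := by
          rintro rfl
          have := ht_nonneg E
          simp at h7; omega
        rw [wt_append_D_tail h3 hF h4]
        split_ifs <;> rw [pow_add] <;> ring

/-- The path E D F' ends at its floor `-2` and starts with U. Dropping that U gives an arbitrary
walk ending at its floor `-3`, and the first passage recovers the pair. -/
theorem sum_nonempty_dyckPairs (n : ℕ) :
    ∑ p ∈ (dyckPairs (n + 2)).filter (fun p => p.1 ≠ [] ∧ p.2 ≠ []),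
      q ^ wt 0 (p.1 ++ D :: p.2.tail) = walkSum n (n + 3) 3 := by
  refine Finset.sum_nbij (fun p => (p.1 ++ D :: p.2.tail).tail) ?_ ?_ ?_ ?_
  · rintro ⟨E, F⟩ hp
    simp only [Finset.mem_filter, mem_dyckPairs] at hp
    obtain ⟨⟨h1, h2, h3, h4, h5⟩, h6, h7⟩ := hp
    obtain ⟨E, rfl⟩ := exists_eq_U_cons h1 h6
    obtain ⟨F, rfl⟩ := exists_eq_U_cons h3 h7
    rw [Finset.mem_filter, mem_words_iff]
    simp only [List.cons_append, List.tail_cons, mn_append, lev_append, mn_cons, lev_cons,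
      rise_U, rise_D, List.length_append, List.length_cons] at *
    push_cast
    omega
  · rintro ⟨E, F⟩ hp ⟨E', F'⟩ hp' e
    simp only [Finset.mem_coe, Finset.mem_filter, mem_dyckPairs] at hp hp'
    obtain ⟨⟨h1, h2, h3, h4, h5⟩, h6, h7⟩ := hp
    obtain ⟨⟨h1', h2', h3', h4', h5'⟩, h6', h7'⟩ := hp'
    obtain ⟨F, rfl⟩ := exists_eq_U_cons h3 h7
    obtain ⟨F', rfl⟩ := exists_eq_U_cons h3' h7'
    have : E ++ D :: F = E' ++ D :: F' := by
      obtain ⟨E, rfl⟩ := exists_eq_U_cons h1 h6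
      obtain ⟨E', rfl⟩ := exists_eq_U_cons h1' h6'
      simpa using e
    obtain ⟨rfl, rfl⟩ := first_passage_unique this h1 h2 h1' h2'
    rfl
  · intro w hw
    rw [Finset.mem_coe, Finset.mem_filter, mem_words_iff] at hw
    obtain ⟨⟨h1, h2⟩, h3⟩ := hw
    obtain ⟨E, F, e, hE, hE0⟩ := exists_first_passage (U :: w) (by
      have := mn_le_lev (U :: w)
      rw [lev_cons, rise_U] at this
      push_cast at h1
      omega)
    have hne : E ≠ [] := by rintro rfl; simp at e
    have e1 := congrArg mn e
    have e2 := congrArg lev e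
    have e3 := congrArg List.length e
    refine ⟨(E, U :: F), ?_, by simp only [List.tail_cons]; rw [← e, List.tail_cons]⟩
    rw [Finset.mem_coe, Finset.mem_filter, mem_dyckPairs]
    simp only [mn_append, lev_append, mn_cons, lev_cons, List.length_append, List.length_cons,
      rise_U, rise_D] at e1 e2 e3 ⊢
    push_cast at h1 h3
    exact ⟨by omega, hne, by simp⟩
  · rintro ⟨E, F⟩ hp
    simp only [Finset.mem_filter, mem_dyckPairs] at hp
    obtain ⟨E, rfl⟩ := exists_eq_U_cons hp.1.1 hp.2.1
    simp

/-- The path that alternates between the levels zero and one. -/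
def zigzag : ℕ → List DyckStep
  | 0 => []
  | n + 1 => U :: D :: zigzag n

theorem mem_dyck_and_ht_le_one {n : ℕ} {l : List DyckStep} :
    (l ∈ dyck n ∧ ht l ≤ 1) ↔ l = zigzag n := by
  rw [mem_dyck]
  induction n generalizing l with
  | zero =>
    constructor
    · rintro ⟨⟨-, -, h⟩, -⟩
      exact List.eq_nil_of_length_eq_zero (by simpa using h)
    · rintro rfl; simp [zigzag]
  | succ n ih =>
    constructor
    · rintro ⟨⟨h1, h2, h3⟩, h4⟩
      obtain ⟨l, rfl⟩ := exists_eq_U_cons h1 (by rintro rfl; simp at h3)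
      rcases l with _ | ⟨_ | _, l⟩
      · simp at h2
      · have := ht_nonneg l
        simp at h4; omega
      · rw [zigzag, ← ih.1 ?_]
        simp only [mn_cons, lev_cons, ht_cons, rise_U, rise_D, List.length_cons] at *
        omega
    · rintro rfl
      have := ih.2 (Eq.refl (zigzag n))
      simp only [zigzag, mn_cons, lev_cons, ht_cons, rise_U, rise_D, List.length_cons] at *
      omega

/-- The descents have weights `k, k + 2, …, k + 2 * n - 2`; the summand `n` on the left avoids
subtraction. -/
theorem wt_D_cons_zigzag (k n : ℕ) : wt k (D :: zigzag n) + n = n * k + n * n := by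
  induction n generalizing k with
  | zero => simp [zigzag]
  | succ n ih =>
    have := ih (k + 1 + 1)
    rw [zigzag, wt_D_U]
    linarith

/-- The sums over the steep pairs and over all Catalan paths, combined into the sum over the pairs
of nonempty Catalan paths. -/
theorem q_sq_mul_sum_steepPairs_add {n : ℕ} (hn : 1 ≤ n) :
    q ^ 2 * (∑ p ∈ steepPairs n, q ^ wt 0 (p.1.dropLast ++ U :: p.2)) +
        ∑ l ∈ dyck n, q ^ wt 0 l =
      ∑ p ∈ (dyckPairs n).filter (fun p => p.1 ≠ [] ∧ p.2 ≠ []),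
        q ^ wt 0 (p.1 ++ D :: p.2.tail) + q ^ ((n - 1) * (n - 1)) := by
  rw [q_sq_mul_sum_steepPairs, sum_dyck_eq_sum_dyckPairs hn,
    ← Finset.sum_filter_add_sum_filter_not
      ((dyckPairs n).filter (fun p => p.2 ≠ [] ∧ ht p.2 ≤ ht p.1 + 1)) (fun p => p.1 ≠ []),
    ← Finset.sum_filter_add_sum_filter_not
      ((dyckPairs n).filter (fun p => p.1 ≠ [] ∧ p.2 ≠ [])) (fun p => ht p.1 + 2 ≤ ht p.2),
    ← add_assoc]
  refine congrArg₂ (· + ·) ?_ ?_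
  · refine congrArg₂ (· + ·) ?_ ?_
    · refine Finset.sum_congr ?_ fun _ _ => rfl
      ext ⟨E, F⟩
      simp only [steepPairs, Finset.mem_filter]
      constructor
      · rintro ⟨h1, h2, h3⟩
        refine ⟨⟨h1, h2, ?_⟩, h3⟩
        rintro rfl
        have := ht_nonneg E
        simp at h3; omega
      · rintro ⟨⟨h1, h2, -⟩, h3⟩
        exact ⟨h1, h2, h3⟩
    · refine Finset.sum_congr ?_ fun _ _ => rfl
      ext ⟨E, F⟩
      simp only [Finset.mem_filter, not_le]
      constructor
      · rintro ⟨⟨h1, h2, h3⟩, h4⟩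
        exact ⟨⟨h1, h4, h2⟩, by omega⟩
      · rintro ⟨⟨h1, h2, h3⟩, h4⟩
        exact ⟨⟨h1, h3, by omega⟩, h2⟩
  -- An empty first path forces the second to have height at most one.
  · have hset : ((dyckPairs n).filter (fun p => p.2 ≠ [] ∧ ht p.2 ≤ ht p.1 + 1)).filter
        (fun p => ¬ p.1 ≠ []) = {([], zigzag n)} := by
      ext ⟨E, F⟩
      rw [Finset.mem_singleton, Prod.mk.injEq, ← mem_dyck_and_ht_le_one, mem_dyck]
      simp only [Finset.mem_filter, mem_dyckPairs, not_not]
      constructor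
      · rintro ⟨⟨h1, h2, h3⟩, rfl⟩
        simp at h1 h3
        exact ⟨rfl, h1, h3⟩
      · rintro ⟨rfl, h1, h2⟩
        refine ⟨⟨by simpa using h1, ?_, by simpa using h2⟩, rfl⟩
        rintro rfl
        simp at h1; omega
    rw [hset, Finset.sum_singleton]
    obtain ⟨m, rfl⟩ := Nat.exists_eq_add_of_le' hn
    have := wt_D_cons_zigzag 1 m
    simp only [zigzag, List.nil_append, List.tail_cons, wt_D_D, Nat.add_sub_cancel, zero_add]
    congr 1
    omega

end

/-! ### Identifying R, X and the two heights -/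

theorem level_eq_lev (p : List DyckStep) (i : ℕ) : level p i = lev (p.take i) := by
  rw [level, lev_eq_count]

theorem maxLevel_le_iff {p : List DyckStep} {a b : ℕ} (h : a ≤ b) (c : ℤ) :
    maxLevel p a b h ≤ c ↔ ∀ i, a ≤ i → i ≤ b → lev (p.take i) ≤ c := by
  simp [maxLevel, Finset.sup'_le_iff, level_eq_lev]

theorem maxLevel_zero_length_eq_ht (p r : List DyckStep) :
    maxLevel (p ++ r) 0 p.length (Nat.zero_le _) = ht p := by
  refine eq_of_forall_ge_iff fun c => ?_
  rw [maxLevel_le_iff, ht_le_iff]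
  constructor
  · intro h i
    rcases le_total i p.length with hi | hi
    · have := h i (Nat.zero_le _) hi
      rwa [List.take_append_of_le_length hi] at this
    · have := h p.length (Nat.zero_le _) le_rfl
      rwa [List.take_append_of_le_length le_rfl, List.take_length, ← List.take_of_length_le hi]
        at this
  · intro h i _ hi
    rw [List.take_append_of_le_length hi]
    exact h i

theorem height_eq_ht (p : List DyckStep) : height p = ht p := by
  simpa [height] using maxLevel_zero_length_eq_ht p []

theorem rightmostMax_eq {a b : List DyckStep} (ha : ht a ≤ lev a) (hb : ht b ≤ 0) :
    rightmostMax (a ++ D :: b) = a.length := by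
  have hlev := lev_le_ht a
  rw [rightmostMax, Nat.findGreatest_eq_iff]
  refine ⟨by simp, fun _ => ?_, fun i h1 h2 h3 => ?_⟩
  · rw [level_eq_lev, height_eq_ht]
    simp
    omega
  · rw [level_eq_lev, height_eq_ht] at h3
    obtain ⟨j, rfl⟩ := Nat.exists_eq_add_of_lt h1
    have := (ht_le_iff b 0).1 hb j
    rw [add_assoc, List.take_length_add_append] at h3
    simp at h3
    omega

theorem lastLevelOne_eq {P A B : List DyckStep} (hP : lev P = 1) (hA : 0 ≤ mn A)
    (h : ht (P ++ U :: A) ≤ lev (P ++ U :: A)) (hB : ht B ≤ 0) :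
    lastLevelOne ((P ++ U :: A) ++ D :: B) = P.length := by
  rw [lastLevelOne, rightmostMax_eq h hB, Nat.findGreatest_eq_iff]
  refine ⟨by simp, fun _ => ?_, fun i h1 h2 h3 => ?_⟩
  · rw [level_eq_lev]
    simp [hP]
  · rw [level_eq_lev, List.take_append_of_le_length h2] at h3
    obtain ⟨j, rfl⟩ := Nat.exists_eq_add_of_lt h1
    have := (le_mn_iff A 0).1 hA j
    rw [add_assoc, List.take_length_add_append] at h3
    simp at h3
    omega

theorem hMinus_eq {P A B : List DyckStep} (hP : lev P = 1) (hA : 0 ≤ mn A)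
    (h : ht (P ++ U :: A) ≤ lev (P ++ U :: A)) (hB : ht B ≤ 0) :
    hMinus ((P ++ U :: A) ++ D :: B) = ht P := by
  simp only [hMinus, lastLevelOne_eq hP hA h hB]
  rw [← maxLevel_zero_length_eq_ht P ((U :: A) ++ D :: B)]
  congr 1
  simp

theorem hPlus_le_ht (p : List DyckStep) : hPlus p ≤ ht p := by
  rw [hPlus, maxLevel_le_iff]
  intro i _ _
  exact (ht_le_iff p _).1 le_rfl i

theorem hMinus_nonneg (p : List DyckStep) : 0 ≤ hMinus p := by
  have := (maxLevel_le_iff (Nat.zero_le (lastLevelOne p)) (hMinus p)).1 le_rfl 0 le_rfl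
    (Nat.zero_le _)
  simpa using this

theorem hPlus_eq {P A B : List DyckStep} (hP : lev P = 1) (hA : 0 ≤ mn A)
    (h : ht (P ++ U :: A) ≤ lev (P ++ U :: A)) (hB : ht B ≤ 0) :
    hPlus ((P ++ U :: A) ++ D :: B) = lev (P ++ U :: A) := by
  apply le_antisymm
  · refine (hPlus_le_ht _).trans ?_
    rw [ht_append, ht_cons, rise_D]
    have := lev_le_ht (P ++ U :: A)
    have := ht_nonneg (P ++ U :: A)
    omega
  · have := (maxLevel_le_iff (lastLevelOne_le_length ((P ++ U :: A) ++ D :: B))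
      (hPlus ((P ++ U :: A) ++ D :: B))).1 le_rfl (P ++ U :: A).length
      (by rw [lastLevelOne_eq hP hA h hB]; simp) (by simp)
    rwa [List.take_append_of_le_length le_rfl, List.take_length] at this

/-- If the inequality of `Omega` fails, the maximum is at least three, so X lies strictly before R
and is followed by an up step; cutting at X and R then gives the decomposition. -/
theorem isSteep_iff {l : List DyckStep} (h : 0 ≤ mn l) (h0 : lev l = 0) (hl : l ≠ []) :
    IsSteep l ↔ ¬ hPlus l ≤ hMinus l + 2 := by
  constructor
  · rintro ⟨P, A, B, rfl, h1, h2, h3, h4, h5⟩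
    rw [hPlus_eq h1 h2 h3 h4, hMinus_eq h1 h2 h3 h4]
    omega
  · intro hh
    have h1 := hPlus_le_ht l
    have h2 := hMinus_nonneg l
    obtain ⟨a, b, rfl, ha, hb⟩ := exists_rightmost_max l (by have := one_le_ht h hl; omega)
    have hlev : 3 ≤ lev a := by
      rw [ht_append, ht_cons, rise_D] at h1
      omega
    obtain ⟨P, A, rfl, hP, hA⟩ := exists_last_visit a 1 (by have := mn_nonpos a; omega)
      (by omega)
    rw [hPlus_eq hP hA ha hb, hMinus_eq hP hA ha hb] at hh
    exact ⟨P, A, b, rfl, hP, hA, ha, hb, by omega⟩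

theorem wt_eq_sum (k : ℕ) (l : List DyckStep) :
    wt k l = ∑ j ∈ Finset.range (l.length - 1),
      if l[j]? = some D ∧ l[j + 1]? = some U then k + j else 0 := by
  induction l generalizing k with
  | nil => simp
  | cons x l ih =>
    rcases l with _ | ⟨y, l⟩
    · simp
    · have e : wt k (x :: y :: l) = wt (k + 1) (y :: l) + if x = D ∧ y = U then k else 0 := by
        rcases x with _ | _ <;> rcases y with _ | _ <;> simp [add_comm]
      rw [e, ih]
      simp only [List.length_cons, Nat.add_sub_cancel]
      rw [Finset.sum_range_succ']
      simp [add_assoc, add_comm 1]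

theorem maj_sub_des (l : List DyckStep) : (maj l : ℤ) - (des l : ℤ) = wt 0 l := by
  have h : maj l = wt 0 l + des l := by
    rw [maj, des, Finset.card_eq_sum_ones, wt_eq_sum, descentSet, Finset.sum_filter,
      Finset.sum_filter, Finset.sum_Ico_eq_sum_range, Finset.sum_Ico_eq_sum_range,
      ← Finset.sum_add_distrib]
    refine Finset.sum_congr rfl fun j _ => ?_
    rw [add_comm 1 j, Nat.add_sub_cancel]
    split_ifs <;> simp
  rw [h]
  push_cast
  ring

/-! ### From `Omega` to lists, and the q-integer identity -/

noncomputable section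

theorem toList_mem_dyck {n : ℕ} (π : CatalanPath n) : π.1.toList ∈ dyck n := by
  obtain ⟨p, hp⟩ := π
  have h := p.count_U_eq_count_D
  have hs : p.toList.count U = n := hp
  change p.toList ∈ dyck n
  rw [mem_dyck, le_mn_iff, length_eq_count, lev_eq_count]
  refine ⟨fun i => ?_, by omega, by omega⟩
  have := p.count_D_le_count_U i
  rw [lev_eq_count]
  omega

open Classical in
theorem sum_Omega {n : ℕ} (hn : 1 ≤ n) :
    ∑ π ∈ Omega n, q ^ ((maj π.1.toList : ℤ) - (des π.1.toList : ℤ)) =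
      ∑ l ∈ (dyck n).filter (fun l => ¬ IsSteep l), q ^ wt 0 l := by
  have ne : ∀ l ∈ dyck n, l ≠ [] := by
    rintro l hl rfl
    rw [mem_dyck] at hl
    simp at hl
    omega
  refine Finset.sum_nbij (fun π => π.1.toList) ?_ ?_ ?_ ?_
  · intro π hπ
    have hd := toList_mem_dyck π
    have hd' := mem_dyck.1 hd
    rw [Omega, Finset.mem_filter] at hπ
    rw [Finset.mem_filter, isSteep_iff hd'.1 hd'.2.1 (ne _ hd), not_not]
    exact ⟨hd, hπ.2⟩
  · intro π _ π' _ h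
    exact Subtype.ext (DyckWord.ext h)
  · intro l hl
    rw [Finset.mem_coe, Finset.mem_filter] at hl
    obtain ⟨hd, hs⟩ := hl
    have hd' := mem_dyck.1 hd
    rw [isSteep_iff hd'.1 hd'.2.1 (ne _ hd), not_not] at hs
    have hc := hd'.2.1
    have hlen := hd'.2.2
    rw [lev_eq_count] at hc
    rw [length_eq_count] at hlen
    refine ⟨⟨⟨l, by omega, fun i => ?_⟩, ?_⟩, ?_, rfl⟩
    · have := (le_mn_iff l 0).1 hd'.1 i
      rw [lev_eq_count] at this
      omega
    · simp only [DyckWord.semilength]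
      omega
    · simp only [Omega, Finset.coe_filter, Finset.mem_univ, true_and, Set.mem_ofPred_eq]
      exact hs
  · intro π _
    rw [maj_sub_des, zpow_natCast]

theorem q_ne_zero : q ≠ 0 := RatFunc.X_ne_zero

theorem q_sub_one_ne_zero : q - 1 ≠ 0 := by
  intro h
  have h4 : q = 1 := sub_eq_zero.1 h
  have h5 : (RatFunc.X : RatFunc ℚ) = RatFunc.C 1 := by simpa using h4
  rw [← RatFunc.algebraMap_X, ← RatFunc.algebraMap_C] at h5
  have := RatFunc.algebraMap_injective ℚ h5
  exact Polynomial.X_ne_C 1 this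

theorem qInt_two_mul (n : ℕ) : qInt (2 * n) = (1 + q ^ n) * qInt n := by
  rw [two_mul, qInt_add]; ring

theorem one_add_q_pow_ne_zero {n : ℕ} (hn : 1 ≤ n) : 1 + q ^ n ≠ 0 := by
  have h := qInt_ne_zero (r := 2 * n) (by omega)
  rw [qInt_two_mul] at h
  exact left_ne_zero_of_mul h

theorem superCatalanT_two (m : ℕ) :
    superCatalanT 2 (m + 1) * (qInt (m + 2) * qInt (m + 3)) =
      qInt 3 * qInt 4 * gauss m (m + 1) := by
  have h1 := one_add_q_pow_ne_zero (n := m + 1) (by omega)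
  have e : 2 * (m + 1) = (2 * m + 1) + 1 := by ring
  have h2 := qInt_two_mul (m + 1)
  have n1 := qFactorial_ne_zero m
  have n3 := qInt_ne_zero (r := 1) (by omega)
  have n4 := qInt_ne_zero (r := 2) (by omega)
  have n5 := qInt_ne_zero (r := m + 1) (by omega)
  have n6 := qInt_ne_zero (r := m + 2) (by omega)
  have n7 := qInt_ne_zero (r := m + 3) (by omega)
  rw [superCatalanT, superCatalanS, gauss, show m + (m + 1) = 2 * m + 1 by ring,
    show 2 + (m + 1) = m + 1 + 1 + 1 by ring, e, qFactorial_succ (2 * m + 1), ← e, h2,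
    show 2 * 2 = 0 + 1 + 1 + 1 + 1 by rfl, show qFactorial 2 = qFactorial (0 + 1 + 1) from rfl]
  simp only [qFactorial_succ m, qFactorial_succ (m + 1), qFactorial_succ (m + 1 + 1),
    qFactorial_succ 0, qFactorial_succ (0 + 1), qFactorial_succ (0 + 1 + 1),
    qFactorial_succ (0 + 1 + 1 + 1), qFactorial_zero, zero_add, Nat.reduceAdd, add_assoc]
  field_simp

theorem gauss_shift (m : ℕ) :
    gauss (m + 3) m * qInt (m + 3) = gauss (m + 1) (m + 2) * qInt (m + 1) := by
  have n1 := qFactorial_ne_zero m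
  have n2 := qInt_ne_zero (r := m + 1) (by omega)
  have n3 := qInt_ne_zero (r := m + 2) (by omega)
  have n4 := qInt_ne_zero (r := m + 3) (by omega)
  rw [gauss, gauss, show m + 1 + (m + 2) = m + 3 + m by ring]
  simp only [qFactorial_succ m, qFactorial_succ (m + 1), qFactorial_succ (m + 2)]
  field_simp

theorem reflectedGauss_shift (m : ℕ) :
    reflectedGauss m (m + 3) 3 * qInt (m + 4) = q ^ 4 * gauss (m + 3) m * qInt m := by
  rcases m with _ | m
  · simp [reflectedGauss]
  · have n1 := qFactorial_ne_zero m
    have n2 := qFactorial_ne_zero (m + 4)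
    have n3 := qInt_ne_zero (r := m + 1) (by omega)
    have n4 := qInt_ne_zero (r := m + 5) (by omega)
    have f1 : qFactorial (m + 5) = qFactorial (m + 4) * qInt (m + 5) := qFactorial_succ (m + 4)
    rw [reflectedGauss, if_pos (by omega), show m + 1 + 3 - (3 + 1) = m by omega,
      show m + 1 + 3 + 1 = m + 5 by omega, show m + 1 + 3 = m + 4 by omega,
      show m + 1 + 4 = m + 5 by omega, gauss, gauss, show m + 4 + (m + 1) = m + 5 + m by omega,
      f1, qFactorial_succ m]
    field_simp
    ring

theorem superCatalanT_two_eq {n : ℕ} (hn : 1 ≤ n) :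
    q ^ (n - 1) * superCatalanT 2 n = (1 + q ^ 2) * ∑ l ∈ dyck n, q ^ wt 0 l -
      ∑ p ∈ (dyckPairs n).filter (fun p => p.1 ≠ [] ∧ p.2 ≠ []),
        q ^ wt 0 (p.1 ++ D :: p.2.tail) := by
  have hq := q_sub_one_ne_zero
  obtain ⟨m, rfl⟩ := Nat.exists_eq_add_of_le' hn
  have hT := superCatalanT_two m
  rw [sum_dyck_succ, Nat.add_sub_cancel]
  have n6 := qInt_ne_zero (r := m + 2) (by omega)
  have n7 := qInt_ne_zero (r := m + 3) (by omega)
  have i3 := qInt_mul 3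
  have i4 := qInt_mul 4
  -- For `n = 1` there is no pair of nonempty paths; the walk formula for pairs starts at `n = 2`.
  rcases m with _ | m
  · have : (dyckPairs (0 + 1)).filter (fun p => p.1 ≠ [] ∧ p.2 ≠ []) = ∅ := by
      rw [Finset.filter_eq_empty_iff]
      rintro ⟨E, F⟩ hp ⟨h1, h2⟩
      rw [mem_dyckPairs] at hp
      obtain ⟨E, rfl⟩ := exists_eq_append_D hp.1 hp.2.1 h1
      obtain ⟨F, rfl⟩ := exists_eq_append_D hp.2.2.1 hp.2.2.2.1 h2
      have h3 := hp.2.1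
      simp only [List.length_append, List.length_cons, List.length_nil] at hp
      have : E = [] := List.eq_nil_of_length_eq_zero (by omega)
      subst this
      simp at h3
    rw [this, walkSum_zero_left (by omega)]
    have i24 : qInt 4 = (1 + q ^ 2) * qInt 2 := qInt_two_mul 2
    apply mul_right_cancel₀ (mul_ne_zero n6 n7)
    simp only [zero_add] at *
    simp only [gauss_zero_left] at hT
    rw [Finset.sum_empty]
    linear_combination hT + qInt 3 * i24
  · have hA := walkSum_eq (m + 1) (m + 2) 1 (by omega)
    rw [reflectedGauss, if_pos (by omega), show m + 2 - (1 + 1) = m by omega] at hA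
    rw [show m + 1 + 1 = m + 2 from rfl, hA, sum_nonempty_dyckPairs,
      walkSum_eq m (m + 3) 3 le_rfl, gauss_comm m]
    have h1 := gauss_shift m
    have h2 := reflectedGauss_shift m
    have j0 := qInt_mul m
    have j1 := qInt_mul (m + 1)
    have j3 := qInt_mul (m + 3)
    have j4 := qInt_mul (m + 4)
    simp only [show m + 1 + 2 = m + 3 from rfl, show m + 1 + 3 = m + 4 from rfl,
      show m + 1 + 1 = m + 2 from rfl, show 1 + 1 = 2 from rfl] at *
    have key : q ^ (m + 1) * (qInt 3 * qInt 4) = (1 + q ^ 2) * (qInt (m + 3) * qInt (m + 4)) -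
        (1 + q ^ 2 + q ^ 4) * (qInt (m + 1) * qInt (m + 4)) +
        q ^ 4 * (qInt (m + 1) * qInt m) := by
      apply mul_left_cancel₀ (mul_ne_zero hq hq)
      calc _ = q ^ (m + 1) * (((q - 1) * qInt 3) * ((q - 1) * qInt 4)) := by ring
        _ = (1 + q ^ 2) * (((q - 1) * qInt (m + 3)) * ((q - 1) * qInt (m + 4))) -
            (1 + q ^ 2 + q ^ 4) * (((q - 1) * qInt (m + 1)) * ((q - 1) * qInt (m + 4))) +
            q ^ 4 * (((q - 1) * qInt (m + 1)) * ((q - 1) * qInt m)) := by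
          rw [i3, i4, j0, j1, j3, j4]; ring
        _ = _ := by ring
    apply mul_right_cancel₀ (mul_ne_zero n6 n7)
    linear_combination q ^ (m + 1) * hT + gauss (m + 1) (m + 2) * key +
      ((1 + q ^ 2 + q ^ 4) * qInt (m + 4) - q ^ 4 * qInt m) * h1 - qInt (m + 3) * h2

end

end SuperCatalan

/-! ### Combining the two identities -/

theorem mainTheorem2 (n : ℕ) (hn : 1 ≤ n) :
    SuperCatalan.superCatalanT 2 n =
      SuperCatalan.q ^ ((n - 1) * (n - 2) : ℤ) +
        SuperCatalan.q ^ (3 - n : ℤ) *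
          ∑ π ∈ SuperCatalan.Omega n,
            SuperCatalan.q ^
              ((SuperCatalan.maj π.1.toList : ℤ) - (SuperCatalan.des π.1.toList : ℤ)) := by
  classical
  have hq := SuperCatalan.q_ne_zero
  rw [SuperCatalan.sum_Omega hn]
  have h1 := SuperCatalan.superCatalanT_two_eq hn
  have h2 := SuperCatalan.q_sq_mul_sum_steepPairs_add hn
  rw [← SuperCatalan.sum_isSteep] at h2
  have h3 := Finset.sum_filter_add_sum_filter_not (SuperCatalan.dyck n) SuperCatalan.IsSteep
    (fun l => SuperCatalan.q ^ SuperCatalan.wt 0 l)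
  obtain ⟨m, rfl⟩ := Nat.exists_eq_add_of_le' hn
  rw [Nat.add_sub_cancel] at h1 h2
  apply mul_left_cancel₀ (pow_ne_zero m hq)
  -- With `m = n - 1`, the exponents are (n-1) + (n-1)(n-2) = (n-1)^2 and, below, (n-1) + (3-n) = 2.
  have e1 : SuperCatalan.q ^ m *
      SuperCatalan.q ^ ((((m + 1 : ℕ) : ℤ) - 1) * (((m + 1 : ℕ) : ℤ) - 2)) =
      SuperCatalan.q ^ (m * m) := by
    rw [← zpow_natCast, ← zpow_natCast, ← zpow_add₀ hq]
    congr 1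
    push_cast
    ring
  have e2 : SuperCatalan.q ^ m * SuperCatalan.q ^ ((3 : ℤ) - ((m + 1 : ℕ) : ℤ)) =
      SuperCatalan.q ^ 2 := by
    rw [← zpow_natCast, ← zpow_natCast, ← zpow_add₀ hq]
    congr 1
    push_cast
    ring
  rw [mul_add, e1, ← mul_assoc, e2, h1]
  linear_combination h2 - SuperCatalan.q ^ 2 * h3
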